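/- All spaces are real. For a Banach space $X$, a set $K\subset X^\ast$ and $\varepsilon>0$, let $$\iota_\varepsilon K=\{x^\ast\in K:\ \operatorname{diam}(K\cap U)>\varepsilon\ \text{for every weak}^\ast\text{-open neighbourhood } U \text{ of } x^\ast\},$$ where the diameter is taken in the dual norm. The space $X$ has *summable Szlenk index* if there is a constant $M$ such that for all $n$ and all $\varepsilon_1,\dots,\varepsilon_n>0$ one has $\sum_{i=1}^n\varepsilon_i\le M$ whenever $\iota_{\varepsilon_1}\cdots\iota_{\varepsilon_n}B_{X^\ast}\neq\varnothing$, where $B_{X^\ast}$ is the closed unit ball of $X^\ast$. Let $T$ be the completion of $c_{00}$ with respect to the norm determined by $$\|x\|=\|x\|_{c_0}\vee\tfrac12\sup\Bigl\{\sum_{j=1}^k\|\mathbf 1_{E_j}x\|:\ \{k\}<E_1<\dots<E_k\Bigr\}\qquad(x\in c_{00}),$$ where $k$ ranges over the positive integers, the $E_j$ are finite, possibly empty, subsets of $\mathbb N=\{1,2,\dots\}$, every element of every $E_j$ is larger than $k$, and every element of $E_i$ is smaller than every element of $E_j$ whenever $i<j$. Let $\mathbb T$ be Tsirelson's space, that is,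 the closed linear span in $T^\ast$ of the coordinate functionals $(e_n)_{n\ge1}$ of the unit vector basis of $T$ (so that $\mathbb T^\ast=T$); $(e_n)$ is a normalized $1$-unconditional basis of $\mathbb T$. Let $\mathbb T(c_0)$ be the $\mathbb T$-direct sum of infinitely many copies of $c_0$, that is, the Banach space of all sequences $(x_n)_{n\ge1}$ in $c_0$ for which $\sum_n\|x_n\|e_n$ converges in $\mathbb T$, with the norm $\bigl\|\sum_n\|x_n\|e_n\bigr\|_{\mathbb T}$. Then $\mathbb T$ has summable Szlenk index, but $\mathbb T(c_0)$ does not have summable Szlenk index. -/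

import Mathlib

open Filter Topology

noncomputable section

/-! ### The Szlenk derivation and summability of the Szlenk index -/

section Szlenk

/-- The `ε`-Szlenk derivation `ι_ε K` of a set `K` of functionals on `X`: the functionals `φ ∈ K`
such that `diam (K ∩ U) > ε` for every weak-star open neighbourhood `U` of `φ`. The diameter is
taken in the dual norm; `U` is an open set of `WeakDual ℝ X`. -/
def szlenkDerivation {X : Type*} [NormedAddCommGroup X] [NormedSpace ℝ X]
    (ε : ℝ) (K : Set (StrongDual ℝ X)) : Set (StrongDual ℝ X) :=
  {φ | φ ∈ K ∧ ∀ U : Set (WeakDual ℝ X), IsOpen U → StrongDual.toWeakDual φ ∈ U →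
    ENNReal.ofReal ε < Metric.ediam (K ∩ StrongDual.toWeakDual ⁻¹' U)}

/-- `iteratedSzlenkDerivation [ε₁, …, εₙ] K = ι_{ε₁} (ι_{ε₂} (… (ι_{εₙ} K)))`. -/
def iteratedSzlenkDerivation {X : Type*} [NormedAddCommGroup X] [NormedSpace ℝ X]
    (ε : List ℝ) (K : Set (StrongDual ℝ X)) : Set (StrongDual ℝ X) :=
  ε.foldr szlenkDerivation K

/-- `X` has summable Szlenk index: there is a constant `M` such that `ε₁ + … + εₙ ≤ M` for all
positive `ε₁, …, εₙ` for which `ι_{ε₁} … ι_{εₙ}` of the closed dual unit ball is nonempty. -/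
def HasSummableSzlenkIndex (X : Type*) [NormedAddCommGroup X] [NormedSpace ℝ X] : Prop :=
  ∃ M : ℝ, ∀ ε : List ℝ, (∀ e ∈ ε, 0 < e) →
    (iteratedSzlenkDerivation ε (Metric.closedBall (0 : StrongDual ℝ X) 1)).Nonempty →
    ε.sum ≤ M

end Szlenk

/-! ### Direct sums with respect to a normalized `1`-unconditional basis -/

/-- A normalized `1`-unconditional (Schauder) basis `(e_n)` of a real Banach space. -/
structure NormalizedOneUnconditionalBasis (E : Type*) [NormedAddCommGroup E] [NormedSpace ℝ E]
    extends GeneralSchauderBasis ℕ ℝ E (SummationFilter.unconditional ℕ) where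
  norm_basis : ∀ n, ‖basis n‖ = 1
  norm_sum_le : ∀ (A : Finset ℕ) (σ a : ℕ → ℝ), (∀ n, |σ n| ≤ 1) →
    ‖∑ n ∈ A, (σ n * a n) • basis n‖ ≤ ‖∑ n ∈ A, a n • basis n‖

namespace NormalizedOneUnconditionalBasis

variable {E : Type*} [NormedAddCommGroup E] [NormedSpace ℝ E]

theorem norm_sum_mono (b : NormalizedOneUnconditionalBasis E) (A : Finset ℕ) {a c : ℕ → ℝ}
    (h : ∀ n, |a n| ≤ |c n|) :
    ‖∑ n ∈ A, a n • b.basis n‖ ≤ ‖∑ n ∈ A, c n • b.basis n‖ := by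
  have key := b.norm_sum_le A (fun n => a n / c n) c (fun n => by
    rw [abs_div]; exact div_le_one_of_le₀ (h n) (abs_nonneg _))
  refine le_trans (le_of_eq ?_) key
  congr 1
  refine Finset.sum_congr rfl fun n _ => ?_
  by_cases hc : c n = 0
  · have : a n = 0 := by
      have := h n
      rw [hc, abs_zero] at this
      exact abs_eq_zero.1 (le_antisymm this (abs_nonneg _))
    simp [this, hc]
  · rw [div_mul_cancel₀ _ hc]

theorem summable_mono [CompleteSpace E] (b : NormalizedOneUnconditionalBasis E) {a c : ℕ → ℝ}
    (h : ∀ n, |a n| ≤ |c n|) (hc : Summable fun n => c n • b.basis n) :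
    Summable fun n => a n • b.basis n := by
  rw [summable_iff_vanishing_norm] at hc ⊢
  intro ε hε
  obtain ⟨s, hs⟩ := hc ε hε
  exact ⟨s, fun t ht => (b.norm_sum_mono t h).trans_lt (hs t ht)⟩

theorem norm_tsum_mono [CompleteSpace E] (b : NormalizedOneUnconditionalBasis E) {a c : ℕ → ℝ}
    (h : ∀ n, |a n| ≤ |c n|) (hc : Summable fun n => c n • b.basis n) :
    ‖∑' n, a n • b.basis n‖ ≤ ‖∑' n, c n • b.basis n‖ :=
  le_of_tendsto_of_tendsto (b.summable_mono h hc).hasSum.norm hc.hasSum.norm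
    (Eventually.of_forall fun A => b.norm_sum_mono A h)

end NormalizedOneUnconditionalBasis

section DirectSum

variable {E : Type*} [NormedAddCommGroup E] [NormedSpace ℝ E] [CompleteSpace E]
  (b : NormalizedOneUnconditionalBasis E)
  (X : ℕ → Type*) [∀ n, NormedAddCommGroup (X n)] [∀ n, NormedSpace ℝ (X n)]

/-- The sequences `(x_n) ∈ ∏ X_n` for which the series `∑ ‖x_n‖ e_n` converges in `E`. (Since
`(e_n)` is an unconditional basis, convergence and unconditional convergence of this series are the
same.) -/
def basisDirectSumSubmodule : Submodule ℝ (∀ n, X n) where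
  carrier := {x | Summable fun n => ‖x n‖ • b.basis n}
  zero_mem' := by simp
  add_mem' := by
    intro x y hx hy
    have hxy : Summable fun n => (‖x n‖ + ‖y n‖) • b.basis n := by
      simpa only [add_smul] using hx.add hy
    exact b.summable_mono (fun n => by
      rw [abs_of_nonneg (norm_nonneg _), abs_of_nonneg (by positivity)]
      exact norm_add_le _ _) hxy
  smul_mem' := by
    intro c x hx
    simpa only [Set.mem_ofPred_eq, Pi.smul_apply, norm_smul, mul_smul] using! hx.const_smul ‖c‖

/-- The `E`-direct sum `(⨁ X_n)_E` of normed spaces `X_n`, where the Banach space `E` has the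
normalized `1`-unconditional basis `(e_n)`: all `(x_n)` for which `∑ ‖x_n‖ e_n` converges, with
the coordinatewise operations and the norm `‖∑ ‖x_n‖ e_n‖`. -/
def BasisDirectSum : Type _ := basisDirectSumSubmodule b X

namespace BasisDirectSum

instance : AddCommGroup (BasisDirectSum b X) :=
  inferInstanceAs (AddCommGroup (basisDirectSumSubmodule b X))

instance : Module ℝ (BasisDirectSum b X) :=
  inferInstanceAs (Module ℝ (basisDirectSumSubmodule b X))

variable {b X}

/-- The `n`-th coordinate. -/
def coord (x : BasisDirectSum b X) (n : ℕ) : X n := x.1 n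

theorem summable_coord (x : BasisDirectSum b X) : Summable fun n => ‖x.coord n‖ • b.basis n := x.2

theorem coord_add (x y : BasisDirectSum b X) (n : ℕ) : (x + y).coord n = x.coord n + y.coord n :=
  rfl

theorem coord_smul (c : ℝ) (x : BasisDirectSum b X) (n : ℕ) : (c • x).coord n = c • x.coord n :=
  rfl

theorem ext_coord {x y : BasisDirectSum b X} (h : ∀ n, x.coord n = y.coord n) : x = y :=
  Subtype.ext (funext h)

instance : Norm (BasisDirectSum b X) := ⟨fun x => ‖∑' n, ‖x.coord n‖ • b.basis n‖⟩

theorem norm_def (x : BasisDirectSum b X) : ‖x‖ = ‖∑' n, ‖x.coord n‖ • b.basis n‖ := rfl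

theorem norm_coord_le (x : BasisDirectSum b X) (n : ℕ) : ‖x.coord n‖ ≤ ‖x‖ := by
  classical
  have h := b.norm_tsum_mono (a := fun m => if m = n then ‖x.coord m‖ else 0)
    (c := fun m => ‖x.coord m‖) (fun m => by
      split_ifs
      · exact le_rfl
      · simp) x.summable_coord
  rw [tsum_eq_single n (by intro m hm; simp [hm])] at h
  simpa [norm_smul, b.norm_basis] using! h

theorem normCore : NormedSpace.Core ℝ (BasisDirectSum b X) where
  norm_nonneg x := by
    rw [norm_def]
    exact norm_nonneg _
  norm_smul c x := by
    simp only [norm_def, coord_smul, norm_smul, mul_smul]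
    rw [tsum_const_smul'' (‖c‖)]
    simp [norm_smul]
  norm_triangle x y := by
    have hxy : Summable fun n => (‖x.coord n‖ + ‖y.coord n‖) • b.basis n := by
      simpa only [add_smul] using x.summable_coord.add y.summable_coord
    calc ‖x + y‖ ≤ ‖∑' n, (‖x.coord n‖ + ‖y.coord n‖) • b.basis n‖ :=
          b.norm_tsum_mono (fun n => by
            rw [abs_of_nonneg (norm_nonneg _), abs_of_nonneg (by positivity)]
            exact norm_add_le _ _) hxy
      _ ≤ ‖x‖ + ‖y‖ := by
          simp only [add_smul]
          rw [x.summable_coord.tsum_add y.summable_coord]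
          exact norm_add_le _ _
  norm_eq_zero_iff x := by
    constructor
    · intro h
      refine ext_coord fun n => ?_
      have := norm_coord_le x n
      rw [h] at this
      exact norm_le_zero_iff.1 this
    · rintro rfl
      have : ∀ n, (0 : BasisDirectSum b X).coord n = 0 := fun n => rfl
      simp [norm_def, this]

instance : NormedAddCommGroup (BasisDirectSum b X) := NormedAddCommGroup.ofCore normCore

instance : NormedSpace ℝ (BasisDirectSum b X) := NormedSpace.ofCore normCore

end BasisDirectSum

end DirectSum

/-! ### Tsirelson's space -/

namespace Tsirelson

/-- Finite sets `E_1, …, E_k` of indices with `{k} < E_1 < … < E_k`, where `E < F` means that every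
element of `E` is smaller than every element of `F` (so empty sets are allowed). Coordinates are
indexed here by `n = 0, 1, 2, …`; the index `n` stands for the `(n + 1)`-st coordinate. -/
def Admissible {k : ℕ} (E : Fin k → Finset ℕ) : Prop :=
  (∀ j, ∀ n ∈ E j, k < n + 1) ∧ ∀ i j, i < j → ∀ m ∈ E i, ∀ n ∈ E j, m < n

/-- The restriction `Ex = 1_E · x` of a finitely supported sequence. -/
def restrict (E : Finset ℕ) (x : ℕ →₀ ℝ) : ℕ →₀ ℝ := x.filter (· ∈ E)

/-- The approximating norms: `|x|_0 = ‖x‖_{c_0}` and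
`|x|_{m+1} = |x|_m ∨ ½ sup {∑_j |E_j x|_m : {k} < E_1 < … < E_k}`. -/
def iterNorm : ℕ → (ℕ →₀ ℝ) → ℝ
  | 0, x => ⨆ n, |x n|
  | m + 1, x => max (iterNorm m x)
      (1 / 2 * sSup {s : ℝ | ∃ (k : ℕ) (E : Fin k → Finset ℕ), Admissible E ∧
        s = ∑ j, iterNorm m (restrict (E j) x)})

/-- The norm of the space `T` of Figiel and Johnson on `c_00`; it satisfies the implicit formula
`norm_formula` below. -/
def norm (x : ℕ →₀ ℝ) : ℝ := ⨆ m, iterNorm m x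

theorem restrict_apply (E : Finset ℕ) (x : ℕ →₀ ℝ) (n : ℕ) :
    restrict E x n = if n ∈ E then x n else 0 := by
  simp [restrict, Finsupp.filter_apply]

theorem restrict_add (E : Finset ℕ) (x y : ℕ →₀ ℝ) :
    restrict E (x + y) = restrict E x + restrict E y := Finsupp.filter_add

theorem restrict_smul (E : Finset ℕ) (c : ℝ) (x : ℕ →₀ ℝ) :
    restrict E (c • x) = c • restrict E x := Finsupp.filter_smul

/-- The `ℓ_1`-norm on `c_00`. -/
def l1 (x : ℕ →₀ ℝ) : ℝ := ∑ n ∈ x.support, |x n|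

theorem l1_nonneg (x : ℕ →₀ ℝ) : 0 ≤ l1 x := Finset.sum_nonneg fun _ _ => abs_nonneg _

theorem abs_le_l1 (x : ℕ →₀ ℝ) (n : ℕ) : |x n| ≤ l1 x := by
  by_cases h : n ∈ x.support
  · exact Finset.single_le_sum (f := fun n => |x n|) (fun _ _ => abs_nonneg _) h
  · rw [Finsupp.notMem_support_iff.1 h, abs_zero]
    exact l1_nonneg x

theorem l1_restrict (E : Finset ℕ) (x : ℕ →₀ ℝ) :
    l1 (restrict E x) = ∑ n ∈ x.support, if n ∈ E then |x n| else 0 := by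
  unfold l1
  have hs : (restrict E x).support ⊆ x.support := by
    intro n hn
    rw [Finsupp.mem_support_iff, restrict_apply] at hn
    rw [Finsupp.mem_support_iff]
    intro h
    simp [h] at hn
  rw [Finset.sum_subset hs]
  · refine Finset.sum_congr rfl fun n _ => ?_
    rw [restrict_apply]
    split_ifs <;> simp
  · intro n _ hn
    rw [Finsupp.notMem_support_iff.1 hn, abs_zero]

theorem Admissible.eq_of_mem {k : ℕ} {E : Fin k → Finset ℕ} (hE : Admissible E) {n : ℕ}
    {i j : Fin k} (hi : n ∈ E i) (hj : n ∈ E j) : i = j := by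
  rcases lt_trichotomy i j with h | h | h
  · exact absurd (hE.2 i j h n hi n hj) (lt_irrefl _)
  · exact h
  · exact absurd (hE.2 j i h n hj n hi) (lt_irrefl _)

theorem sum_l1_restrict_le {k : ℕ} {E : Fin k → Finset ℕ} (hE : Admissible E) (x : ℕ →₀ ℝ) :
    ∑ j, l1 (restrict (E j) x) ≤ l1 x := by
  simp only [l1_restrict]
  rw [Finset.sum_comm]
  refine Finset.sum_le_sum fun n _ => ?_
  by_cases h : ∃ j, n ∈ E j
  · obtain ⟨j, hj⟩ := h
    rw [Finset.sum_eq_single j]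
    · simp [hj]
    · intro i _ hij
      rw [if_neg]
      exact fun hi => hij (hE.eq_of_mem hi hj)
    · simp
  · push Not at h
    simp [h]

theorem admissible_empty : Admissible (Fin.elim0 : Fin 0 → Finset ℕ) :=
  ⟨fun j => j.elim0, fun j => j.elim0⟩

theorem iterNorm_bounds (m : ℕ) : ∀ x, 0 ≤ iterNorm m x ∧ iterNorm m x ≤ l1 x := by
  induction m with
  | zero =>
    intro x
    exact ⟨Real.iSup_nonneg fun _ => abs_nonneg _, ciSup_le fun n => abs_le_l1 x n⟩
  | succ m ih =>
    intro x
    refine ⟨le_max_of_le_left (ih x).1, max_le (ih x).2 ?_⟩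
    have h : sSup {s : ℝ | ∃ (k : ℕ) (E : Fin k → Finset ℕ), Admissible E ∧
        s = ∑ j, iterNorm m (restrict (E j) x)} ≤ l1 x := by
      refine csSup_le ⟨0, 0, Fin.elim0, admissible_empty, by simp⟩ ?_
      rintro s ⟨k, E, hE, rfl⟩
      exact (Finset.sum_le_sum fun j _ => (ih _).2).trans (sum_l1_restrict_le hE x)
    linarith [l1_nonneg x]

theorem iterNorm_zero_le_iff {x : ℕ →₀ ℝ} {B : ℝ} :
    iterNorm 0 x ≤ B ↔ ∀ n, |x n| ≤ B :=
  ciSup_le_iff ⟨l1 x, by rintro _ ⟨n, rfl⟩; exact abs_le_l1 x n⟩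

theorem half_sSup_le_iff {F : (ℕ →₀ ℝ) → ℝ} (hF : ∀ x, F x ≤ l1 x) {x : ℕ →₀ ℝ} {B : ℝ} :
    1 / 2 * sSup {s : ℝ | ∃ (k : ℕ) (E : Fin k → Finset ℕ), Admissible E ∧
        s = ∑ j, F (restrict (E j) x)} ≤ B ↔
      ∀ (k : ℕ) (E : Fin k → Finset ℕ), Admissible E →
        1 / 2 * ∑ j, F (restrict (E j) x) ≤ B := by
  have hb : BddAbove {s : ℝ | ∃ (k : ℕ) (E : Fin k → Finset ℕ), Admissible E ∧
      s = ∑ j, F (restrict (E j) x)} := by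
    refine ⟨l1 x, ?_⟩
    rintro s ⟨k, E, hE, rfl⟩
    exact (Finset.sum_le_sum fun j _ => hF _).trans (sum_l1_restrict_le hE x)
  constructor
  · intro h k E hE
    have := le_csSup hb ⟨k, E, hE, rfl⟩
    linarith
  · intro h
    have : sSup {s : ℝ | ∃ (k : ℕ) (E : Fin k → Finset ℕ), Admissible E ∧
        s = ∑ j, F (restrict (E j) x)} ≤ 2 * B := by
      refine csSup_le ⟨0, 0, Fin.elim0, admissible_empty, by simp⟩ ?_
      rintro s ⟨k, E, hE, rfl⟩
      linarith [h k E hE]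
    linarith

theorem iterNorm_succ_le_iff {m : ℕ} {x : ℕ →₀ ℝ} {B : ℝ} :
    iterNorm (m + 1) x ≤ B ↔ iterNorm m x ≤ B ∧
      ∀ (k : ℕ) (E : Fin k → Finset ℕ), Admissible E →
        1 / 2 * ∑ j, iterNorm m (restrict (E j) x) ≤ B := by
  rw [iterNorm, max_le_iff, half_sSup_le_iff fun x => (iterNorm_bounds m x).2]

theorem iterNorm_mono_nat (x : ℕ →₀ ℝ) : Monotone fun m => iterNorm m x :=
  monotone_nat_of_le_succ fun _ => (iterNorm_succ_le_iff.1 le_rfl).1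

/-- The norms `iterNorm m` are lattice norms. -/
theorem iterNorm_mono (m : ℕ) : ∀ {x y : ℕ →₀ ℝ}, (∀ n, |x n| ≤ |y n|) →
    iterNorm m x ≤ iterNorm m y := by
  induction m with
  | zero =>
    intro x y h
    exact iterNorm_zero_le_iff.2 fun n => (h n).trans (iterNorm_zero_le_iff.1 le_rfl n)
  | succ m ih =>
    intro x y h
    have hy := iterNorm_succ_le_iff.1 (le_refl (iterNorm (m + 1) y))
    refine iterNorm_succ_le_iff.2 ⟨(ih h).trans hy.1, fun k E hE => le_trans ?_ (hy.2 k E hE)⟩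
    refine mul_le_mul_of_nonneg_left (Finset.sum_le_sum fun j _ => ih fun n => ?_) (by norm_num)
    simp only [restrict_apply]
    split_ifs
    · exact h n
    · simp

theorem iterNorm_add_le (m : ℕ) : ∀ x y : ℕ →₀ ℝ,
    iterNorm m (x + y) ≤ iterNorm m x + iterNorm m y := by
  induction m with
  | zero =>
    intro x y
    refine iterNorm_zero_le_iff.2 fun n => (abs_add_le _ _).trans (add_le_add ?_ ?_)
    · exact iterNorm_zero_le_iff.1 le_rfl n
    · exact iterNorm_zero_le_iff.1 le_rfl n
  | succ m ih =>
    intro x y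
    have hx := iterNorm_succ_le_iff.1 (le_refl (iterNorm (m + 1) x))
    have hy := iterNorm_succ_le_iff.1 (le_refl (iterNorm (m + 1) y))
    refine iterNorm_succ_le_iff.2 ⟨(ih x y).trans (add_le_add hx.1 hy.1), fun k E hE => ?_⟩
    refine le_trans ?_ (add_le_add (hx.2 k E hE) (hy.2 k E hE))
    rw [← mul_add, ← Finset.sum_add_distrib]
    refine mul_le_mul_of_nonneg_left (Finset.sum_le_sum fun j _ => ?_) (by norm_num)
    rw [restrict_add]
    exact ih _ _

theorem iterNorm_smul_le (m : ℕ) (c : ℝ) : ∀ x : ℕ →₀ ℝ,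
    iterNorm m (c • x) ≤ |c| * iterNorm m x := by
  induction m with
  | zero =>
    intro x
    refine iterNorm_zero_le_iff.2 fun n => ?_
    rw [Finsupp.smul_apply, smul_eq_mul, abs_mul]
    exact mul_le_mul_of_nonneg_left (iterNorm_zero_le_iff.1 le_rfl n) (abs_nonneg _)
  | succ m ih =>
    intro x
    have hx := iterNorm_succ_le_iff.1 (le_refl (iterNorm (m + 1) x))
    refine iterNorm_succ_le_iff.2
      ⟨(ih x).trans (mul_le_mul_of_nonneg_left hx.1 (abs_nonneg _)), fun k E hE => ?_⟩
    refine le_trans ?_ (mul_le_mul_of_nonneg_left (hx.2 k E hE) (abs_nonneg c))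
    rw [mul_left_comm, Finset.mul_sum Finset.univ _ |c|]
    have h2 : (0 : ℝ) ≤ 1 / 2 := by norm_num
    refine mul_le_mul_of_nonneg_left (Finset.sum_le_sum fun j _ => ?_) h2
    rw [restrict_smul]
    exact ih _

theorem norm_le_iff {x : ℕ →₀ ℝ} {B : ℝ} : norm x ≤ B ↔ ∀ m, iterNorm m x ≤ B :=
  ciSup_le_iff ⟨l1 x, by rintro _ ⟨m, rfl⟩; exact (iterNorm_bounds m x).2⟩

theorem iterNorm_le_norm (m : ℕ) (x : ℕ →₀ ℝ) : iterNorm m x ≤ norm x := norm_le_iff.1 le_rfl m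

theorem norm_le_l1 (x : ℕ →₀ ℝ) : norm x ≤ l1 x := norm_le_iff.2 fun m => (iterNorm_bounds m x).2

theorem norm_nonneg (x : ℕ →₀ ℝ) : 0 ≤ norm x :=
  (iterNorm_bounds 0 x).1.trans (iterNorm_le_norm 0 x)

theorem abs_le_norm (x : ℕ →₀ ℝ) (n : ℕ) : |x n| ≤ norm x :=
  iterNorm_zero_le_iff.1 (iterNorm_le_norm 0 x) n

theorem norm_mono {x y : ℕ →₀ ℝ} (h : ∀ n, |x n| ≤ |y n|) : norm x ≤ norm y :=
  norm_le_iff.2 fun m => (iterNorm_mono m h).trans (iterNorm_le_norm m y)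

theorem norm_add_le (x y : ℕ →₀ ℝ) : norm (x + y) ≤ norm x + norm y :=
  norm_le_iff.2 fun m => (iterNorm_add_le m x y).trans
    (add_le_add (iterNorm_le_norm m x) (iterNorm_le_norm m y))

theorem norm_smul_le (c : ℝ) (x : ℕ →₀ ℝ) : norm (c • x) ≤ |c| * norm x :=
  norm_le_iff.2 fun m => (iterNorm_smul_le m c x).trans
    (mul_le_mul_of_nonneg_left (iterNorm_le_norm m x) (abs_nonneg _))

theorem norm_smul (c : ℝ) (x : ℕ →₀ ℝ) : norm (c • x) = |c| * norm x := by
  refine le_antisymm (norm_smul_le c x) ?_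
  by_cases hc : c = 0
  · subst hc
    simpa using norm_nonneg _
  · have h := norm_smul_le c⁻¹ (c • x)
    rw [smul_smul, inv_mul_cancel₀ hc, one_smul, abs_inv] at h
    rwa [← le_inv_mul_iff₀ (abs_pos.2 hc)]

theorem tendsto_iterNorm (x : ℕ →₀ ℝ) : Tendsto (fun m => iterNorm m x) atTop (𝓝 (norm x)) :=
  tendsto_atTop_ciSup (iterNorm_mono_nat x)
    ⟨l1 x, by rintro _ ⟨m, rfl⟩; exact (iterNorm_bounds m x).2⟩

/-- The implicit formula
`‖x‖ = ‖x‖_{c_0} ∨ ½ sup {∑_{j ≤ k} ‖E_j x‖ : {k} < E_1 < … < E_k}` for `x ∈ c_00`. -/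
theorem norm_formula (x : ℕ →₀ ℝ) :
    norm x = max (⨆ n, |x n|)
      (1 / 2 * sSup {s : ℝ | ∃ (k : ℕ) (E : Fin k → Finset ℕ), Admissible E ∧
        s = ∑ j, norm (restrict (E j) x)}) := by
  apply le_antisymm
  · refine norm_le_iff.2 fun m => ?_
    induction m with
    | zero => exact le_max_left _ _
    | succ m ih =>
      refine iterNorm_succ_le_iff.2 ⟨ih, fun k E hE => le_max_of_le_right ?_⟩
      refine le_trans ?_ ((half_sSup_le_iff norm_le_l1).1 le_rfl k E hE)
      exact mul_le_mul_of_nonneg_left (Finset.sum_le_sum fun j _ => iterNorm_le_norm m _)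
        (by norm_num)
  · refine max_le (iterNorm_le_norm 0 x) ((half_sSup_le_iff norm_le_l1).2 fun k E hE => ?_)
    have ht : Tendsto (fun m => 1 / 2 * ∑ j, iterNorm m (restrict (E j) x)) atTop
        (𝓝 (1 / 2 * ∑ j, norm (restrict (E j) x))) :=
      (tendsto_finsetSum _ fun j _ => tendsto_iterNorm _).const_mul _
    exact le_of_tendsto' ht fun m =>
      ((iterNorm_succ_le_iff.1 le_rfl).2 k E hE).trans (iterNorm_le_norm (m + 1) x)

theorem norm_single (n : ℕ) (c : ℝ) : norm (Finsupp.single n c) = |c| := by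
  apply le_antisymm
  · refine (norm_le_l1 _).trans ?_
    unfold l1
    refine (Finset.sum_le_sum_of_subset_of_nonneg Finsupp.support_single_subset
      fun _ _ _ => abs_nonneg _).trans ?_
    simp
  · simpa using abs_le_norm (Finsupp.single n c) n

/-- The space `c_00` with the norm `Tsirelson.norm`. -/
def C00 : Type := ℕ →₀ ℝ

namespace C00

instance : AddCommGroup C00 := inferInstanceAs (AddCommGroup (ℕ →₀ ℝ))

instance : Module ℝ C00 := inferInstanceAs (Module ℝ (ℕ →₀ ℝ))

instance : Norm C00 := ⟨fun x => Tsirelson.norm (show ℕ →₀ ℝ from x)⟩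

/-- The identity map from finitely supported sequences to `C00`. -/
def of : (ℕ →₀ ℝ) ≃ₗ[ℝ] C00 := LinearEquiv.refl ℝ (ℕ →₀ ℝ)

theorem norm_of (x : ℕ →₀ ℝ) : ‖of x‖ = Tsirelson.norm x := rfl

theorem normCore : NormedSpace.Core ℝ C00 where
  norm_nonneg x := Tsirelson.norm_nonneg x
  norm_smul c x := Tsirelson.norm_smul c x
  norm_triangle x y := Tsirelson.norm_add_le x y
  norm_eq_zero_iff x := by
    constructor
    · intro h
      refine Finsupp.ext fun n => ?_
      have := abs_le_norm x n
      rw [show Tsirelson.norm x = 0 from h] at this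
      exact abs_eq_zero.1 (le_antisymm this (abs_nonneg _))
    · rintro rfl
      have h0 : l1 (0 : ℕ →₀ ℝ) = 0 := by simp [l1]
      exact le_antisymm ((norm_le_l1 (0 : ℕ →₀ ℝ)).trans h0.le) (Tsirelson.norm_nonneg _)

instance : NormedAddCommGroup C00 := NormedAddCommGroup.ofCore normCore

instance : NormedSpace ℝ C00 := NormedSpace.ofCore normCore

/-- The `n`-th coordinate functional on `c_00`. -/
def coord (n : ℕ) : StrongDual ℝ C00 :=
  LinearMap.mkContinuous ((Finsupp.lapply n : (ℕ →₀ ℝ) →ₗ[ℝ] ℝ) ∘ₗ of.symm.toLinearMap) 1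
    fun x => by
      rw [one_mul]
      exact abs_le_norm (of.symm x) n

theorem coord_of (n : ℕ) (x : ℕ →₀ ℝ) : coord n (of x) = x n := rfl

end C00

/-- The space `T` of Figiel and Johnson: the completion of `c_00`. -/
abbrev T : Type := UniformSpace.Completion C00

/-- The canonical embedding of `c_00` into `T`. -/
def T.of : (ℕ →₀ ℝ) →ₗ[ℝ] T :=
  (UniformSpace.Completion.toComplL (𝕜 := ℝ) (E := C00)).toLinearMap ∘ₗ C00.of.toLinearMap

/-- The unit vectors of `T`. -/
def T.unit (n : ℕ) : T := T.of (Finsupp.single n 1)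

/-- The coordinate functionals on `T` (the continuous extensions from `c_00`). -/
def T.coord (n : ℕ) : StrongDual ℝ T :=
  (C00.coord n).extend (UniformSpace.Completion.toComplL (𝕜 := ℝ) (E := C00))

theorem T.norm_of (x : ℕ →₀ ℝ) : ‖T.of x‖ = Tsirelson.norm x :=
  UniformSpace.Completion.norm_coe (C00.of x)

theorem T.coord_of (n : ℕ) (x : ℕ →₀ ℝ) : T.coord n (T.of x) = x n :=
  ContinuousLinearMap.extend_eq _ UniformSpace.Completion.denseRange_coe
    (UniformSpace.Completion.isUniformInducing_coe C00) (C00.of x)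

theorem T.denseRange_of : DenseRange T.of := UniformSpace.Completion.denseRange_coe (α := C00)

/-- A functional on `T` is bounded by its bound on `c_00`. -/
theorem T.opNorm_le {φ : StrongDual ℝ T} {B : ℝ} (hB : 0 ≤ B)
    (h : ∀ x : ℕ →₀ ℝ, |φ (T.of x)| ≤ B * Tsirelson.norm x) : ‖φ‖ ≤ B := by
  refine φ.opNorm_le_bound hB fun x => ?_
  refine T.denseRange_of.induction_on x ?_ fun y => ?_
  · exact isClosed_le (by fun_prop) (by fun_prop)
  · rw [T.norm_of]
    exact h y

theorem T.norm_coord (n : ℕ) : ‖T.coord n‖ = 1 := by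
  apply le_antisymm
  · refine T.opNorm_le zero_le_one fun x => ?_
    rw [T.coord_of, one_mul]
    exact abs_le_norm x n
  · have h := (T.coord n).le_opNorm (T.unit n)
    rw [T.unit, T.coord_of, T.norm_of, norm_single] at h
    simpa using h

/-- Multiplying the coordinates of a functional on `T` in a finite set of coordinates by scalars of
modulus at most `1`, and dropping the others, does not increase the norm. -/
theorem T.norm_sum_le (φ : StrongDual ℝ T) (A : Finset ℕ) (σ : ℕ → ℝ) (hσ : ∀ n, |σ n| ≤ 1) :
    ‖∑ n ∈ A, (σ n * φ (T.unit n)) • T.coord n‖ ≤ ‖φ‖ := by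
  refine T.opNorm_le (_root_.norm_nonneg φ) fun x => ?_
  have h1 : (∑ n ∈ A, (σ n * φ (T.unit n)) • T.coord n) (T.of x)
      = φ (T.of (∑ n ∈ A, Finsupp.single n (σ n * x n))) := by
    simp only [map_sum, FunLike.coe_sum, Finset.sum_apply,
      _root_.smul_apply, T.coord_of]
    refine Finset.sum_congr rfl fun n _ => ?_
    have : Finsupp.single n (σ n * x n) = (σ n * x n) • Finsupp.single n (1 : ℝ) := by simp
    rw [this, map_smul, map_smul, T.unit]
    simp only [smul_eq_mul]
    ring
  rw [h1]
  refine (φ.le_opNorm _).trans (mul_le_mul_of_nonneg_left ?_ (_root_.norm_nonneg φ))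
  rw [T.norm_of]
  refine norm_mono fun n => ?_
  rw [Finsupp.finsetSum_apply]
  by_cases hn : n ∈ A
  · rw [Finset.sum_eq_single_of_mem n hn
      (fun m _ hm => by rw [Finsupp.single_apply, if_neg hm])]
    rw [Finsupp.single_eq_same, abs_mul]
    exact mul_le_of_le_one_left (abs_nonneg _) (hσ n)
  · rw [Finset.sum_eq_zero]
    · simp
    · intro m hm
      rw [Finsupp.single_apply, if_neg]
      rintro rfl
      exact hn hm

end Tsirelson

/-- Tsirelson's space `𝕋`, the predual of the space `T` of Figiel and Johnson: the closed linear
span in `T*` of the coordinate functionals of the unit vector basis of `T`. (As `T` is reflexive,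
this is all of `T*`, and the dual of `𝕋` is `T`.) -/
def tsirelsonSubmodule : Submodule ℝ (StrongDual ℝ Tsirelson.T) :=
  (Submodule.span ℝ (Set.range Tsirelson.T.coord)).topologicalClosure

/-- Tsirelson's space `𝕋`, with the norm of `T*`. -/
def TsirelsonSpace : Type := tsirelsonSubmodule

namespace TsirelsonSpace

instance : NormedAddCommGroup TsirelsonSpace :=
  inferInstanceAs (NormedAddCommGroup tsirelsonSubmodule)

instance : NormedSpace ℝ TsirelsonSpace := inferInstanceAs (NormedSpace ℝ tsirelsonSubmodule)

instance : CompleteSpace TsirelsonSpace :=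
  (Submodule.isClosed_topologicalClosure
    (Submodule.span ℝ (Set.range Tsirelson.T.coord))).completeSpace_coe

/-- The inclusion of `𝕋` into `T*`. -/
def toDual : TsirelsonSpace →ₗᵢ[ℝ] StrongDual ℝ Tsirelson.T := tsirelsonSubmodule.subtypeₗᵢ

/-- The unit vectors of Tsirelson's space. -/
def unit (n : ℕ) : TsirelsonSpace :=
  ⟨Tsirelson.T.coord n, Submodule.le_topologicalClosure _ (Submodule.subset_span ⟨n, rfl⟩)⟩

theorem toDual_unit (n : ℕ) : toDual (unit n) = Tsirelson.T.coord n := rfl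

/-- The coordinate functionals on Tsirelson's space: evaluation at the unit vectors of `T`. -/
def coord (n : ℕ) : StrongDual ℝ TsirelsonSpace :=
  (ContinuousLinearMap.apply ℝ ℝ (Tsirelson.T.unit n)).comp toDual.toContinuousLinearMap

theorem coord_apply (n : ℕ) (φ : TsirelsonSpace) :
    coord n φ = toDual φ (Tsirelson.T.unit n) := rfl

theorem coord_unit (i j : ℕ) : coord i (unit j) = (Pi.single j (1 : ℝ) : ℕ → ℝ) i := by
  rw [coord_apply, toDual_unit, Tsirelson.T.unit, Tsirelson.T.coord_of, Finsupp.single_apply,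
    Pi.single_apply]

theorem norm_sum_coord_le (φ : TsirelsonSpace) (A : Finset ℕ) (σ : ℕ → ℝ)
    (hσ : ∀ n, |σ n| ≤ 1) : ‖∑ n ∈ A, (σ n * coord n φ) • unit n‖ ≤ ‖φ‖ := by
  have h := Tsirelson.T.norm_sum_le (toDual φ) A σ hσ
  rw [toDual.norm_map] at h
  refine le_trans (le_of_eq ?_) h
  rw [← toDual.norm_map, map_sum]
  simp only [map_smul, toDual_unit, coord_apply]

theorem span_unit_dense : Dense (Submodule.span ℝ (Set.range unit) : Set TsirelsonSpace) := by
  intro φ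
  rw [Metric.mem_closure_iff]
  intro ε hε
  have hφ : toDual φ ∈
      closure (Submodule.span ℝ (Set.range Tsirelson.T.coord) : Set (StrongDual ℝ Tsirelson.T)) :=
    φ.2
  obtain ⟨ψ, hψ, hd⟩ := Metric.mem_closure_iff.1 hφ ε hε
  have hmap : Submodule.span ℝ (Set.range Tsirelson.T.coord)
      = (Submodule.span ℝ (Set.range unit)).map toDual.toLinearMap := by
    rw [Submodule.map_span, ← Set.range_comp]
    rfl
  rw [hmap] at hψ
  obtain ⟨χ, hχ, rfl⟩ := hψ
  exact ⟨χ, hχ, by rwa [← toDual.dist_map]⟩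

theorem sum_coord_unit_of_mem_span {ψ : TsirelsonSpace}
    (hψ : ψ ∈ Submodule.span ℝ (Set.range unit)) :
    ∃ s : Finset ℕ, ∀ A, s ⊆ A → ∑ n ∈ A, coord n ψ • unit n = ψ := by
  classical
  induction hψ using Submodule.span_induction with
  | mem x hx =>
    obtain ⟨j, rfl⟩ := hx
    refine ⟨{j}, fun A hA => ?_⟩
    rw [Finset.sum_eq_single_of_mem j (hA (Finset.mem_singleton_self j))]
    · rw [coord_unit, Pi.single_eq_same, one_smul]
    · intro n _ hn
      rw [coord_unit, Pi.single_eq_of_ne hn, zero_smul]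
  | zero => exact ⟨∅, fun A _ => by simp⟩
  | add x y _ _ hx hy =>
    obtain ⟨s, hs⟩ := hx
    obtain ⟨t, ht⟩ := hy
    refine ⟨s ∪ t, fun A hA => ?_⟩
    simp only [map_add, add_smul, Finset.sum_add_distrib]
    rw [hs A (Finset.union_subset_left hA), ht A (Finset.union_subset_right hA)]
  | smul c x _ hx =>
    obtain ⟨s, hs⟩ := hx
    refine ⟨s, fun A hA => ?_⟩
    simp only [map_smul, smul_eq_mul, mul_smul]
    rw [← Finset.smul_sum, hs A hA]

theorem hasSum_coord_unit (φ : TsirelsonSpace) : HasSum (fun n => coord n φ • unit n) φ := by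
  rw [HasSum, SummationFilter.unconditional_filter, Metric.tendsto_atTop]
  intro ε hε
  obtain ⟨ψ, hψ, hd⟩ := Metric.mem_closure_iff.1 (span_unit_dense φ) (ε / 2) (by positivity)
  obtain ⟨s, hs⟩ := sum_coord_unit_of_mem_span hψ
  refine ⟨s, fun A hA => ?_⟩
  have h1 : ‖∑ n ∈ A, coord n (φ - ψ) • unit n‖ ≤ ‖φ - ψ‖ := by
    simpa using norm_sum_coord_le (φ - ψ) A (fun _ => 1) (by simp)
  have h2 : ∑ n ∈ A, coord n φ • unit n - φ
      = (∑ n ∈ A, coord n (φ - ψ) • unit n) - (φ - ψ) := by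
    simp only [map_sub, sub_smul, Finset.sum_sub_distrib]
    rw [hs A hA]
    abel
  rw [dist_eq_norm] at hd ⊢
  rw [h2]
  calc _ ≤ _ := norm_sub_le _ _
    _ < ε := by linarith

/-- The canonical normalized `1`-unconditional basis of Tsirelson's space. -/
def basis : NormalizedOneUnconditionalBasis TsirelsonSpace where
  basis := unit
  coord := coord
  ortho i j := by
    rw [coord_unit]
    congr!
  expansion := hasSum_coord_unit
  norm_basis n := Tsirelson.T.norm_coord n
  norm_sum_le A σ a hσ := by
    have h := norm_sum_coord_le (∑ n ∈ A, a n • unit n) A σ hσ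
    refine le_trans (le_of_eq ?_) h
    congr 1
    refine Finset.sum_congr rfl fun n hn => ?_
    congr 2
    rw [map_sum, Finset.sum_eq_single_of_mem n hn]
    · rw [map_smul, coord_unit, Pi.single_eq_same, smul_eq_mul, mul_one]
    · intro m _ hm
      rw [map_smul, coord_unit, Pi.single_eq_of_ne (Ne.symm hm), smul_zero]

end TsirelsonSpace

/-- The `𝕋`-direct sum `𝕋(c_0)` of infinitely many copies of `c_0`, where `c_0` is realized as
`C₀(ℕ, ℝ)`, the null sequences with the supremum norm. -/
abbrev TsirelsonSumC0 : Type :=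
  BasisDirectSum TsirelsonSpace.basis fun _ : ℕ => ZeroAtInftyContinuousMap ℕ ℝ

end

/-!
The dual norm of a functional `φ` on `𝕋` is the supremum of the norms in `T` of the truncations of
its coordinate sequence (`TsirelsonSpace.norm_block_le`, `TsirelsonSpace.norm_le_of_norm_block_le`),
so both claims come down to the norm of `T`.

`𝕋` has summable Szlenk index because `k` successive blocks supported beyond `k` span a copy of
`ℓ_1^k` in `T`, up to the constant `2`. If `φ` survives `n` derivations with parameters `ε_1, …, ε_n`,
then, since the tails of the functionals are small in norm
(`TsirelsonSpace.exists_forall_norm_block_le`), one finds in the dual ball a functional with `n`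
successive blocks of norm about `ε_i / 2`
(`TsirelsonSpace.exists_blocks_of_mem_iteratedSzlenkDerivation`). The place where the blocks start is
free, so they can be taken beyond `n`, and the lower `ℓ_1`-estimate bounds `∑ ε_i`.

In `𝕋(c_0)` the perturbations need not move far out: each copy of `c_0` has a weak-star null sequence
of normalized coordinate functionals, so a perturbation can be made in any prescribed copy and still
be weak-star small. Hence, for every `a ≥ 0` in `c_00` with `‖a‖_T ≤ 1`, the origin survives the
derivations with parameters `a_n / 2`, `n ∈ supp a`
(`TsirelsonSumC0.sum_smul_eval_mem_iteratedSzlenkDerivation`). The sums `∑ a_n` are unbounded because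
the norm of `T` is not equivalent to the `ℓ_1`-norm: combining convex combinations of the unit vectors
of norm at most `θ` suitably gives ones of norm at most `7/8 θ`
(`Tsirelson.HasSmallAverages.improve`).
-/

namespace Tsirelson

/-! ### Small averages in `T` -/

theorem half_sum_norm_restrict_le {k : ℕ} {E : Fin k → Finset ℕ} (hE : Admissible E)
    (x : ℕ →₀ ℝ) : 1 / 2 * ∑ j, norm (restrict (E j) x) ≤ norm x := by
  have h := norm_formula x
  exact (half_sSup_le_iff norm_le_l1).1 ((le_max_right _ _).trans h.ge) k E hE

theorem norm_le_of_forall {x : ℕ →₀ ℝ} {B : ℝ} (h0 : ∀ n, |x n| ≤ B)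
    (h1 : ∀ (k : ℕ) (E : Fin k → Finset ℕ), Admissible E →
      1 / 2 * ∑ j, norm (restrict (E j) x) ≤ B) : norm x ≤ B := by
  rw [norm_formula]
  exact max_le (ciSup_le h0) ((half_sSup_le_iff norm_le_l1).2 h1)

theorem norm_zero : norm 0 = 0 := by
  simpa using norm_smul 0 (0 : ℕ →₀ ℝ)

theorem norm_finsetSum_le {ι : Type*} (s : Finset ι) (x : ι → ℕ →₀ ℝ) :
    norm (∑ i ∈ s, x i) ≤ ∑ i ∈ s, norm (x i) :=
  Finset.le_sum_of_subadditive norm norm_zero.le norm_add_le s x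

theorem norm_restrict_le (E : Finset ℕ) (x : ℕ →₀ ℝ) : norm (restrict E x) ≤ norm x := by
  refine norm_mono fun n => ?_
  rw [restrict_apply]
  split_ifs
  · exact le_rfl
  · simp

theorem restrict_finsetSum {ι : Type*} (E : Finset ℕ) (s : Finset ι) (x : ι → ℕ →₀ ℝ) :
    restrict E (∑ i ∈ s, x i) = ∑ i ∈ s, restrict E (x i) := by
  ext n
  simp only [restrict_apply, Finsupp.finsetSum_apply]
  split_ifs <;> simp

/-- Of `r` successive blocks, `k` successive sets `E_j` can split at most `k`: a block met by `E_j`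
and by some later `E_{j'}` is the last one that `E_j` meets. The blocks that are not split contribute
at most `θ` each to the sum, the others at most `2θ`. -/
theorem sum_norm_restrict_sum_le {k : ℕ} {E : Fin k → Finset ℕ} (hE : Admissible E) {N : ℕ → ℕ}
    (hN : Monotone N) {x : ℕ → ℕ →₀ ℝ} (hx : ∀ i n, x i n ≠ 0 → N i ≤ n ∧ n < N (i + 1))
    {θ : ℝ} (hθ : ∀ i, norm (x i) ≤ θ) (r : ℕ) :
    ∑ j, norm (restrict (E j) (∑ i ∈ Finset.range r, x i)) ≤ (r + k) * θ := by
  classical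
  have hθ0 : 0 ≤ θ := (norm_nonneg _).trans (hθ 0)
  let meets : ℕ → Fin k → Prop := fun i j => ∃ n ∈ E j, x i n ≠ 0
  let split : ℕ → Fin k → Prop := fun i j => meets i j ∧ ∃ j', j < j' ∧ meets i j'
  have hnot : ∀ i j, ¬ meets i j → norm (restrict (E j) (x i)) = 0 := by
    intro i j h
    have h0 : restrict (E j) (x i) = 0 := by
      ext n
      rw [restrict_apply]
      split_ifs with hn
      · by_contra hne
        exact h ⟨n, hn, hne⟩
      · rfl
    rw [h0, norm_zero]
  have hcard : ((Finset.range r).filter fun i => ∃ j, split i j).card ≤ k := by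
    have := Finset.card_le_card_of_forall_subsingleton (s := (Finset.range r).filter fun i => ∃ j,
      split i j) (t := (Finset.univ : Finset (Fin k))) split (fun i hi => by
        obtain ⟨j, hj⟩ := (Finset.mem_filter.1 hi).2
        exact ⟨j, Finset.mem_univ j, hj⟩) (fun j _ => by
        have key : ∀ i i', split i j → split i' j → ¬ i < i' := by
          rintro i i' ⟨-, j', hjj', p, hp, hpx⟩ ⟨⟨q, hq, hqx⟩, -⟩ hlt
          have h1 := hE.2 j j' hjj' q hq p hp
          have h2 := (hx i p hpx).2
          have h3 := hN (Nat.succ_le_of_lt hlt)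
          have h4 := (hx i' q hqx).1
          simp only [Nat.succ_eq_add_one] at h3
          omega
        rintro i ⟨-, hi⟩ i' ⟨-, hi'⟩
        have := key i i' hi hi'
        have := key i' i hi' hi
        omega)
    simpa using this
  have hone : ∀ i, ∑ j, norm (restrict (E j) (x i)) ≤ θ + if ∃ j, split i j then θ else 0 := by
    intro i
    split_ifs with hs
    · linarith [half_sum_norm_restrict_le hE (x i), hθ i]
    · rw [add_zero]
      by_cases h : ∃ j, meets i j
      · obtain ⟨j, hj⟩ := h
        rw [Finset.sum_eq_single j]
        · exact (norm_restrict_le _ _).trans (hθ i)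
        · intro j' _ hne
          refine hnot i j' fun hj' => hs ?_
          rcases lt_or_gt_of_ne hne with h | h
          · exact ⟨j', hj', j, h, hj⟩
          · exact ⟨j, hj, j', h, hj'⟩
        · simp
      · rw [Finset.sum_eq_zero fun j _ => hnot i j fun hj => h ⟨j, hj⟩]
        exact hθ0
  calc ∑ j, norm (restrict (E j) (∑ i ∈ Finset.range r, x i))
      ≤ ∑ j, ∑ i ∈ Finset.range r, norm (restrict (E j) (x i)) :=
        Finset.sum_le_sum fun j _ => by
          rw [restrict_finsetSum]
          exact norm_finsetSum_le _ _
    _ = ∑ i ∈ Finset.range r, ∑ j, norm (restrict (E j) (x i)) := Finset.sum_comm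
    _ ≤ ∑ i ∈ Finset.range r, (θ + if ∃ j, split i j then θ else 0) :=
        Finset.sum_le_sum fun i _ => hone i
    _ = r * θ + ((Finset.range r).filter fun i => ∃ j, split i j).card * θ := by
        rw [Finset.sum_add_distrib, ← Finset.sum_filter]
        simp
    _ ≤ (r + k) * θ := by
        rw [add_mul]
        have : (((Finset.range r).filter fun i => ∃ j, split i j).card : ℝ) ≤ k := by
          exact_mod_cast hcard
        gcongr

/-- The sum of the coordinates of a finitely supported sequence. -/
noncomputable def coordSum : (ℕ →₀ ℝ) →ₗ[ℝ] ℝ := Finsupp.linearCombination ℝ fun _ => (1 : ℝ)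

theorem coordSum_apply (x : ℕ →₀ ℝ) : coordSum x = ∑ n ∈ x.support, x n := by
  simp [coordSum, Finsupp.linearCombination_apply, Finsupp.sum]

/-- Arbitrarily far out there are convex combinations of the unit vectors of `T` whose norm is at
most `θ`. -/
def HasSmallAverages (θ : ℝ) : Prop :=
  ∀ N : ℕ, ∃ (x : ℕ →₀ ℝ) (M : ℕ), N ≤ M ∧ (∀ n, 0 ≤ x n) ∧ (∀ n, x n ≠ 0 → N ≤ n ∧ n < M) ∧
    coordSum x = 1 ∧ norm x ≤ θ

/-- Given successive convex combinations `x₀ < x₁ < … < x_r` of norm at most `θ`, where `r` is large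
compared with the support of `x₀`, the combination `½ (x₀ + (x₁ + … + x_r) / r)` has norm at most
`7/8 θ`: admissible families of more sets than `max (supp x₀)` do not see `x₀`, and those of fewer
sets sum to at most `2θ` on `x₀` and to at most `3/2 θ` on the average of the other blocks. -/
theorem HasSmallAverages.improve {θ : ℝ} (h : HasSmallAverages θ) :
    HasSmallAverages (7 / 8 * θ) := by
  intro N₀
  choose f β hβ hnn hsupp hsum hnorm using h
  have hθ0 : 0 ≤ θ := (norm_nonneg _).trans (hnorm 0)
  let N : ℕ → ℕ := fun i => β^[i] N₀
  have hNs : ∀ i, N (i + 1) = β (N i) := fun i => Function.iterate_succ_apply' _ _ _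
  have hN : Monotone N := monotone_nat_of_le_succ fun i => by rw [hNs]; exact hβ _
  let x : ℕ → ℕ →₀ ℝ := fun i => f (N i)
  have hx : ∀ i n, x i n ≠ 0 → N i ≤ n ∧ n < N (i + 1) := fun i n hn => by
    rw [hNs]; exact hsupp _ n hn
  -- An admissible family of `k < N 1 < r / 2` sets splits less than half of the `r` later blocks.
  obtain ⟨r, hr⟩ : ∃ r, r = 2 * N 1 + 1 := ⟨_, rfl⟩
  have hr0 : (0 : ℝ) < r := by exact_mod_cast (by omega : 0 < r)
  let s : ℕ →₀ ℝ := ∑ i ∈ Finset.range r, x (i + 1)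
  let z : ℕ →₀ ℝ := (1 / r : ℝ) • s
  let y : ℕ →₀ ℝ := (1 / 2 : ℝ) • (x 0 + z)
  have hs_apply : ∀ n, s n = ∑ i ∈ Finset.range r, x (i + 1) n := fun n =>
    Finsupp.finsetSum_apply _ _ _
  have hz_norm : norm z ≤ θ := by
    rw [norm_smul, abs_of_pos (by positivity)]
    have h1 : norm s ≤ r * θ := by
      refine (norm_finsetSum_le _ _).trans ?_
      refine (Finset.sum_le_sum fun i _ => hnorm _).trans ?_
      simp
    calc (1 / r : ℝ) * norm s ≤ 1 / r * (r * θ) := by gcongr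
      _ = θ := by field_simp
  have hs_supp : ∀ n, s n ≠ 0 → N 1 ≤ n ∧ n < N (r + 1) := by
    intro n hn
    rw [hs_apply] at hn
    obtain ⟨i, hi, hin⟩ := Finset.exists_ne_zero_of_sum_ne_zero hn
    have h1 := hx (i + 1) n hin
    have h2 := hN (show 1 ≤ i + 1 by omega)
    have h3 := hN (show i + 1 + 1 ≤ r + 1 by have := Finset.mem_range.1 hi; omega)
    omega
  have hy_apply : ∀ n, y n = 1 / 2 * (x 0 n + 1 / r * s n) := fun n => by
    simp [y, z]
    ring
  refine ⟨y, N (r + 1), hN (Nat.zero_le _), fun n => ?_, fun n hn => ?_, ?_, ?_⟩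
  · rw [hy_apply, hs_apply]
    have h1 : 0 ≤ ∑ i ∈ Finset.range r, x (i + 1) n := Finset.sum_nonneg fun i _ => hnn _ n
    have h2 : 0 ≤ x 0 n := hnn _ n
    positivity
  · rw [hy_apply] at hn
    by_cases h0 : x 0 n = 0
    · have h1 : s n ≠ 0 := fun hs => hn (by rw [h0, hs]; simp)
      have h2 := hN (show 0 ≤ 1 by omega)
      have h3 := hs_supp n h1
      change N 0 ≤ n ∧ _
      omega
    · have h1 := hx 0 n h0
      have h2 := hN (show 0 + 1 ≤ r + 1 by omega)
      change N 0 ≤ n ∧ _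
      omega
  · have h1 : coordSum s = r := by
      simp only [s, map_sum]
      rw [Finset.sum_congr rfl fun i _ => hsum (N (i + 1))]
      simp
    have h2 : coordSum (x 0) = 1 := hsum _
    simp only [y, z, map_smul, map_add, h1, h2, smul_eq_mul]
    field_simp
    norm_num
  · refine norm_le_of_forall (fun n => ?_) fun k E hE => ?_
    · -- At each `n`, only one of `x 0` and `z` can be nonzero.
      by_cases hn : n < N 1
      · have h1 : s n = 0 := by
          by_contra hs
          have := hs_supp n hs
          omega
        have h2 : |x 0 n| ≤ θ := (abs_le_norm _ _).trans (hnorm _)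
        rw [hy_apply, h1, mul_zero, add_zero, abs_mul, abs_of_pos (by norm_num : (0 : ℝ) < 1 / 2)]
        linarith
      · have h1 : x 0 n = 0 := by
          by_contra hs
          have := hx 0 n hs
          simp only [Nat.zero_add] at this
          omega
        have h2 : |z n| ≤ θ := (abs_le_norm _ _).trans hz_norm
        have h3 : y n = 1 / 2 * z n := by simp [y, h1]
        rw [h3, abs_mul, abs_of_pos (by norm_num : (0 : ℝ) < 1 / 2)]
        linarith
    · by_cases hk : N 1 ≤ k
      · have h1 : ∀ j, restrict (E j) y = restrict (E j) ((1 / 2 : ℝ) • z) := by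
          intro j
          ext n
          rw [restrict_apply, restrict_apply]
          split_ifs with hn
          · have h2 := hE.1 j n hn
            have h1 : x 0 n = 0 := by
              by_contra hs
              have := hx 0 n hs
              simp only [Nat.zero_add] at this
              omega
            simp [y, h1]
          · rfl
        simp only [h1]
        refine (half_sum_norm_restrict_le hE _).trans ?_
        rw [norm_smul, abs_of_pos (by norm_num : (0 : ℝ) < 1 / 2)]
        linarith
      · have h1 : ∑ j, norm (restrict (E j) y) ≤ 1 / 2 * (∑ j, norm (restrict (E j) (x 0)) +
            1 / r * ∑ j, norm (restrict (E j) s)) := by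
          rw [Finset.mul_sum Finset.univ _ (1 / r : ℝ), ← Finset.sum_add_distrib, Finset.mul_sum]
          refine Finset.sum_le_sum fun j _ => ?_
          simp only [y, z, restrict_smul, restrict_add, norm_smul]
          rw [abs_of_pos (by norm_num : (0 : ℝ) < 1 / 2)]
          have := norm_add_le (restrict (E j) (x 0)) ((1 / r : ℝ) • restrict (E j) s)
          rw [norm_smul, abs_of_pos (by positivity)] at this
          linarith
        have h2 := half_sum_norm_restrict_le hE (x 0)
        have h3 : norm (x 0) ≤ θ := hnorm _
        have h4 := sum_norm_restrict_sum_le hE (N := fun i => N (i + 1))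
          (fun a b hab => hN (by omega)) (x := fun i => x (i + 1)) (fun i n => hx (i + 1) n)
          (fun i => hnorm (N (i + 1))) r
        have h5 : 1 / r * ∑ j, norm (restrict (E j) s) ≤ 3 / 2 * θ := by
          have h6 : (k : ℝ) ≤ r / 2 := by
            have : 2 * k ≤ r := by omega
            have : (2 : ℝ) * k ≤ r := by exact_mod_cast this
            linarith
          calc 1 / r * ∑ j, norm (restrict (E j) s) ≤ 1 / r * ((r + k) * θ) := by gcongr
            _ ≤ 1 / r * ((r + r / 2) * θ) := by gcongr
            _ = 3 / 2 * θ := by field_simp; ring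
        linarith

theorem hasSmallAverages_pow (m : ℕ) : HasSmallAverages ((7 / 8) ^ m) := by
  induction m with
  | zero =>
    intro N
    refine ⟨Finsupp.single N 1, N + 1, Nat.le_succ N, fun n => ?_, fun n hn => ?_, ?_, ?_⟩
    · rw [Finsupp.single_apply]
      split_ifs <;> norm_num
    · rw [Finsupp.single_apply] at hn
      have : N = n := by
        by_contra h
        simp [h] at hn
      omega
    · simp [coordSum]
    · simp [norm_single]
  | succ m ih =>
    rw [pow_succ']
    exact ih.improve

/-- The norm of `T` is not equivalent to the `ℓ_1`-norm on `c_00`. -/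
theorem exists_norm_le_one_lt_coordSum (B : ℝ) :
    ∃ a : ℕ →₀ ℝ, (∀ n, 0 ≤ a n) ∧ norm a ≤ 1 ∧ B < coordSum a := by
  obtain ⟨m, hm⟩ := pow_unbounded_of_one_lt B (by norm_num : (1 : ℝ) < 8 / 7)
  obtain ⟨x, -, -, hnn, -, hsum, hnorm⟩ := hasSmallAverages_pow m 0
  refine ⟨((8 / 7 : ℝ) ^ m) • x, fun n => ?_, ?_, ?_⟩
  · have := hnn n
    simp only [Finsupp.smul_apply, smul_eq_mul]
    positivity
  · rw [norm_smul, abs_of_pos (by positivity)]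
    calc (8 / 7 : ℝ) ^ m * norm x ≤ (8 / 7) ^ m * (7 / 8) ^ m := by gcongr
      _ = 1 := by rw [← mul_pow]; norm_num
  · rwa [map_smul, hsum, smul_eq_mul, mul_one]

end Tsirelson

section Szlenk

variable {X : Type*} [NormedAddCommGroup X] [NormedSpace ℝ X]

/-! ### The Szlenk derivation in terms of points far away -/

theorem exists_norm_sub_gt_of_mem_szlenkDerivation {ε : ℝ}
    {K : Set (StrongDual ℝ X)} {φ : StrongDual ℝ X} (hφ : φ ∈ szlenkDerivation ε K)
    {U : Set (WeakDual ℝ X)} (hU : IsOpen U) (hφU : StrongDual.toWeakDual φ ∈ U) :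
    ∃ ψ ∈ K, StrongDual.toWeakDual ψ ∈ U ∧ ε / 2 < ‖ψ - φ‖ := by
  by_contra! h
  refine (hφ.2 U hU hφU).not_ge (Metric.ediam_le fun ψ hψ χ hχ => ?_)
  rw [edist_dist]
  refine ENNReal.ofReal_le_ofReal ?_
  have h1 := h ψ hψ.1 hψ.2
  have h2 := h χ hχ.1 hχ.2
  rw [← dist_eq_norm] at h1 h2
  linarith [dist_triangle_right ψ χ φ]

theorem mem_szlenkDerivation_of_tendsto {ε : ℝ} (hε : 0 ≤ ε) {K : Set (StrongDual ℝ X)}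
    {φ : StrongDual ℝ X} (hφ : φ ∈ K) {ψ : ℕ → StrongDual ℝ X} (hψ : ∀ p, ψ p ∈ K)
    (hlim : ∀ x, Tendsto (fun p => ψ p x) atTop (𝓝 (φ x))) (hfar : ∀ p, ε < ‖ψ p - φ‖) :
    φ ∈ szlenkDerivation ε K := by
  refine ⟨hφ, fun U hU hφU => ?_⟩
  have ht : Tendsto (fun p => StrongDual.toWeakDual (ψ p)) atTop (𝓝 (StrongDual.toWeakDual φ)) :=
    tendsto_iff_forall_eval_tendsto_topDualPairing.2 hlim
  obtain ⟨p, hp⟩ := (ht.eventually (hU.mem_nhds hφU)).exists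
  refine lt_of_lt_of_le ?_ (Metric.edist_le_ediam_of_mem (x := ψ p) (y := φ) ⟨hψ p, hp⟩ ⟨hφ, hφU⟩)
  rw [edist_dist, dist_eq_norm]
  exact (ENNReal.ofReal_lt_ofReal_iff (hε.trans_lt (hfar p))).2 (hfar p)

end Szlenk

/-! ### The sum `𝕋(c_0)` -/

namespace TsirelsonSpace

theorem toDual_of (φ : TsirelsonSpace) (x : ℕ →₀ ℝ) :
    toDual φ (Tsirelson.T.of x) = ∑ n ∈ x.support, x n * coord n φ := by
  have h : x = ∑ n ∈ x.support, x n • Finsupp.single n (1 : ℝ) := by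
    conv_lhs => rw [← Finsupp.sum_single x]
    simp [Finsupp.sum]
  conv_lhs => rw [h]
  simp only [map_sum, map_smul, smul_eq_mul, coord_apply, Tsirelson.T.unit]

theorem abs_toDual_of_le (φ : TsirelsonSpace) (x : ℕ →₀ ℝ) :
    |toDual φ (Tsirelson.T.of x)| ≤ Tsirelson.norm x * ‖φ‖ := by
  have h := (toDual φ).le_opNorm (Tsirelson.T.of x)
  rwa [toDual.norm_map, Tsirelson.T.norm_of, mul_comm] at h

theorem coord_tsum {c : ℕ → ℝ} (hc : Summable fun n => c n • unit n) (m : ℕ) :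
    coord m (∑' n, c n • unit n) = c m := by
  rw [(coord m).map_tsum hc, tsum_eq_single m]
  · simp [coord_unit]
  · intro n hn
    rw [map_smul, coord_unit, Pi.single_eq_of_ne (Ne.symm hn), smul_zero]

end TsirelsonSpace

namespace TsirelsonSumC0

/-- The functional on `𝕋(c_0)` that sends `(x_n)` to the `p`-th coordinate of `x_n`. -/
noncomputable def eval (n p : ℕ) : StrongDual ℝ TsirelsonSumC0 :=
  LinearMap.mkContinuous
    { toFun := fun x => x.coord n p
      map_add' := fun _ _ => rfl
      map_smul' := fun _ _ => rfl } 1 fun x => by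
    rw [one_mul]
    exact ((x.coord n).toBCF.norm_coe_le_norm p).trans (BasisDirectSum.norm_coord_le x n)

theorem eval_apply (n p : ℕ) (x : TsirelsonSumC0) : eval n p x = x.coord n p := rfl

theorem one_le_norm_eval (n p : ℕ) : 1 ≤ ‖eval n p‖ := by
  classical
  let v : ZeroAtInftyContinuousMap ℕ ℝ :=
    ⟨⟨Pi.single p 1, continuous_of_discreteTopology⟩, by
      rw [Filter.cocompact_eq_cofinite, Nat.cofinite_eq_atTop]
      refine tendsto_const_nhds.congr' ?_
      filter_upwards [eventually_gt_atTop p] with q hq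
      exact (Pi.single_eq_of_ne (M := fun _ => ℝ) hq.ne' 1).symm⟩
  have hv : ‖v‖ ≤ 1 := by
    refine (BoundedContinuousFunction.norm_le zero_le_one).2 fun q => ?_
    change ‖(Pi.single p 1 : ℕ → ℝ) q‖ ≤ 1
    rw [Pi.single_apply]
    split_ifs <;> simp
  have hzero : ∀ m, m ≠ n → ‖(Pi.single n v : ℕ → ZeroAtInftyContinuousMap ℕ ℝ) m‖ •
      TsirelsonSpace.basis.basis m = 0 := by
    intro m hm
    rw [Pi.single_eq_of_ne hm, norm_zero, zero_smul]
  let x : TsirelsonSumC0 := ⟨Pi.single n v, (hasSum_single n hzero).summable⟩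
  have hx : ‖x‖ ≤ 1 := by
    rw [BasisDirectSum.norm_def]
    change ‖∑' m, ‖(Pi.single n v : ℕ → ZeroAtInftyContinuousMap ℕ ℝ) m‖ •
      TsirelsonSpace.basis.basis m‖ ≤ 1
    rw [tsum_eq_single n hzero, Pi.single_eq_same, norm_smul, TsirelsonSpace.basis.norm_basis,
      norm_norm, mul_one]
    exact hv
  have hval : eval n p x = 1 := by
    change (Pi.single n v : ℕ → ZeroAtInftyContinuousMap ℕ ℝ) n p = 1
    rw [Pi.single_eq_same]
    exact Pi.single_eq_same (M := fun _ => ℝ) p 1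
  have h := (eval n p).le_opNorm x
  rw [hval, norm_one] at h
  nlinarith [norm_nonneg (eval n p)]

theorem tendsto_eval (n : ℕ) (x : TsirelsonSumC0) :
    Tendsto (fun p => eval n p x) atTop (𝓝 0) := by
  have h := (x.coord n).zero_at_infty'
  rwa [Filter.cocompact_eq_cofinite, Nat.cofinite_eq_atTop] at h

theorem norm_sum_smul_eval_le (a : ℕ →₀ ℝ) (S : Finset ℕ) (m : ℕ → ℕ) :
    ‖∑ n ∈ S, a n • eval n (m n)‖ ≤ Tsirelson.norm a := by
  refine ContinuousLinearMap.opNorm_le_bound _ (Tsirelson.norm_nonneg a) fun x => ?_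
  let b : ℕ →₀ ℝ := ∑ n ∈ S, Finsupp.single n |a n|
  have hb : ∀ n, b n = if n ∈ S then |a n| else 0 := fun n => by
    simp [b, Finsupp.finsetSum_apply, Finsupp.single_apply]
  have hbn : Tsirelson.norm b ≤ Tsirelson.norm a := by
    refine Tsirelson.norm_mono fun n => ?_
    rw [hb]
    split_ifs <;> simp
  have hbs : b.support ⊆ S := by
    intro n hn
    by_contra h
    rw [Finsupp.mem_support_iff, hb, if_neg h] at hn
    exact hn rfl
  calc ‖(∑ n ∈ S, a n • eval n (m n)) x‖ = |∑ n ∈ S, a n * x.coord n (m n)| := by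
        simp [eval_apply]
    _ ≤ ∑ n ∈ S, b n * ‖x.coord n‖ := by
        refine (Finset.abs_sum_le_sum_abs _ _).trans (Finset.sum_le_sum fun n hn => ?_)
        rw [abs_mul, hb, if_pos hn]
        exact mul_le_mul_of_nonneg_left ((x.coord n).toBCF.norm_coe_le_norm (m n)) (abs_nonneg _)
    _ = TsirelsonSpace.toDual (∑' n, ‖x.coord n‖ • TsirelsonSpace.unit n) (Tsirelson.T.of b) := by
        rw [TsirelsonSpace.toDual_of]
        refine (Finset.sum_subset hbs fun n _ hn => ?_).symm.trans
          (Finset.sum_congr rfl fun n _ => ?_)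
        · rw [Finsupp.notMem_support_iff.1 hn, zero_mul]
        · rw [TsirelsonSpace.coord_tsum x.summable_coord]
    _ ≤ Tsirelson.norm b * ‖x‖ := (le_abs_self _).trans (TsirelsonSpace.abs_toDual_of_le _ _)
    _ ≤ Tsirelson.norm a * ‖x‖ := by gcongr

/-- Adding `a_n • eval n p` and letting `p → ∞` moves a functional by at least `a_n`
in norm and not at all in the weak-star limit; so each index of `L` can be spent on one derivation. -/
theorem sum_smul_eval_mem_iteratedSzlenkDerivation {a : ℕ →₀ ℝ} (ha : Tsirelson.norm a ≤ 1) :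
    ∀ (L : List ℕ), L.Nodup → (∀ n ∈ L, 0 < a n) → ∀ (S : Finset ℕ) (m : ℕ → ℕ),
      (∀ n ∈ L, n ∉ S) → ∑ n ∈ S, a n • eval n (m n) ∈
        iteratedSzlenkDerivation (L.map fun n => a n / 2)
          (Metric.closedBall (0 : StrongDual ℝ TsirelsonSumC0) 1) := by
  intro L
  induction L with
  | nil =>
    intro _ _ S m _
    simpa [iteratedSzlenkDerivation] using (norm_sum_smul_eval_le a S m).trans ha
  | cons l L ih =>
    intro hL hpos S m hS
    rw [List.nodup_cons] at hL
    simp only [List.mem_cons, forall_eq_or_imp] at hpos hS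
    have hsum : ∀ p, ∑ n ∈ insert l S, a n • eval n (Function.update m l p n)
        = a l • eval l p + ∑ n ∈ S, a n • eval n (m n) := by
      intro p
      rw [Finset.sum_insert hS.1, Function.update_self]
      congr 1
      refine Finset.sum_congr rfl fun n hn => ?_
      rw [Function.update_of_ne]
      rintro rfl
      exact hS.1 hn
    refine mem_szlenkDerivation_of_tendsto (half_pos hpos.1).le (ih hL.2 hpos.2 S m hS.2)
      (ψ := fun p => a l • eval l p + ∑ n ∈ S, a n • eval n (m n)) (fun p => ?_) (fun x => ?_)
      fun p => ?_
    · rw [← hsum]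
      refine ih hL.2 hpos.2 _ _ fun n hn => ?_
      rw [Finset.mem_insert, not_or]
      exact ⟨fun h => hL.1 (h ▸ hn), hS.2 n hn⟩
    · simpa using! ((tendsto_eval l x).const_mul (a l)).add_const
        ((∑ n ∈ S, a n • eval n (m n)) x)
    · rw [add_sub_cancel_right, norm_smul, Real.norm_of_nonneg hpos.1.le]
      nlinarith [one_le_norm_eval l p, hpos.1]

theorem not_hasSummableSzlenkIndex : ¬ HasSummableSzlenkIndex TsirelsonSumC0 := by
  rintro ⟨M, hM⟩
  obtain ⟨a, hnn, hnorm, hlt⟩ := Tsirelson.exists_norm_le_one_lt_coordSum (2 * M)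
  have hpos : ∀ n ∈ a.support.toList, 0 < a n := fun n hn =>
    lt_of_le_of_ne (hnn n) (Finsupp.mem_support_iff.1 (Finset.mem_toList.1 hn)).symm
  have h := hM (a.support.toList.map fun n => a n / 2) (fun e he => by
    obtain ⟨n, hn, rfl⟩ := List.mem_map.1 he
    exact half_pos (hpos n hn))
    ⟨_, sum_smul_eval_mem_iteratedSzlenkDerivation hnorm _ (Finset.nodup_toList _) hpos ∅
      (fun _ => 0) (by simp)⟩
  rw [Finset.sum_map_toList, ← Finset.sum_div, ← Tsirelson.coordSum_apply] at h
  linarith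

end TsirelsonSumC0

/-! ### The dual of `𝕋` -/

namespace TsirelsonSpace

/-- The part in `E` of the sequence `(φ (e_n))` that represents a functional `φ` on `𝕋`. -/
noncomputable def block (E : Finset ℕ) : StrongDual ℝ TsirelsonSpace →ₗ[ℝ] (ℕ →₀ ℝ) where
  toFun φ := ∑ n ∈ E, Finsupp.single n (φ (unit n))
  map_add' φ ψ := by simp [Finset.sum_add_distrib]
  map_smul' c φ := by simp [Finset.smul_sum]

theorem block_def (E : Finset ℕ) (φ : StrongDual ℝ TsirelsonSpace) :
    block E φ = ∑ n ∈ E, Finsupp.single n (φ (unit n)) := rfl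

theorem block_apply (E : Finset ℕ) (φ : StrongDual ℝ TsirelsonSpace) (n : ℕ) :
    block E φ n = if n ∈ E then φ (unit n) else 0 := by
  simp [block_def, Finsupp.finsetSum_apply, Finsupp.single_apply]

theorem norm_block_mono {E F : Finset ℕ} (h : E ⊆ F) (φ : StrongDual ℝ TsirelsonSpace) :
    Tsirelson.norm (block E φ) ≤ Tsirelson.norm (block F φ) := by
  refine Tsirelson.norm_mono fun n => ?_
  rw [block_apply, block_apply]
  by_cases hn : n ∈ E
  · rw [if_pos hn, if_pos (h hn)]
  · rw [if_neg hn, abs_zero]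
    exact abs_nonneg _

theorem norm_block_le_sum (E : Finset ℕ) (φ : StrongDual ℝ TsirelsonSpace) :
    Tsirelson.norm (block E φ) ≤ ∑ n ∈ E, |φ (unit n)| := by
  refine (Tsirelson.norm_finsetSum_le _ _).trans (Finset.sum_le_sum fun n _ => ?_)
  rw [Tsirelson.norm_single]

theorem of_block (E : Finset ℕ) (φ : StrongDual ℝ TsirelsonSpace) :
    Tsirelson.T.of (block E φ) = ∑ n ∈ E, φ (unit n) • Tsirelson.T.unit n := by
  rw [block_def, map_sum]
  refine Finset.sum_congr rfl fun n _ => ?_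
  rw [Tsirelson.T.unit, ← map_smul, Finsupp.smul_single, smul_eq_mul, mul_one]

theorem norm_block_le (E : Finset ℕ) (φ : StrongDual ℝ TsirelsonSpace) :
    Tsirelson.norm (block E φ) ≤ ‖φ‖ := by
  -- A norming functional of the block, restricted to `E`, is an element of the unit ball of `𝕋`.
  obtain ⟨f, hf, hfa⟩ := exists_dual_vector'' ℝ (Tsirelson.T.of (block E φ))
  let ψ : TsirelsonSpace := ∑ n ∈ E, f (Tsirelson.T.unit n) • unit n
  have hψ : ‖ψ‖ ≤ 1 := by
    have h := Tsirelson.T.norm_sum_le f E (fun _ => 1) (by simp)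
    simp only [one_mul] at h
    rw [← toDual.norm_map]
    simp only [ψ, map_sum, map_smul, toDual_unit]
    exact h.trans hf
  have hφψ : φ ψ = Tsirelson.norm (block E φ) := by
    rw [← Tsirelson.T.norm_of]
    refine Eq.trans ?_ hfa
    rw [of_block]
    simp only [ψ, map_sum, map_smul, smul_eq_mul, mul_comm]
  calc Tsirelson.norm (block E φ) = φ ψ := hφψ.symm
    _ ≤ ‖φ‖ * ‖ψ‖ := (le_abs_self _).trans (φ.le_opNorm ψ)
    _ ≤ ‖φ‖ := mul_le_of_le_one_right (norm_nonneg φ) hψ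

theorem norm_le_of_norm_block_le {φ : StrongDual ℝ TsirelsonSpace} {c : ℝ}
    (h : ∀ M, Tsirelson.norm (block (Finset.range M) φ) ≤ c) : ‖φ‖ ≤ c := by
  have hc : 0 ≤ c := (Tsirelson.norm_nonneg _).trans (h 0)
  refine φ.opNorm_le_bound hc fun x => ?_
  refine le_of_tendsto ((hasSum_coord_unit x).mapL φ).norm (Eventually.of_forall fun A => ?_)
  obtain ⟨M, hM⟩ := A.exists_nat_subset_range
  have h1 : ∑ n ∈ A, φ (coord n x • unit n) = toDual x (Tsirelson.T.of (block A φ)) := by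
    rw [of_block]
    simp only [map_sum, map_smul, smul_eq_mul, coord_apply, mul_comm]
  rw [h1]
  refine (abs_toDual_of_le _ _).trans (mul_le_mul_of_nonneg_right ?_ (norm_nonneg x))
  exact (norm_block_mono hM φ).trans (h M)

theorem sum_norm_block_le {k : ℕ} {E : Fin k → Finset ℕ} (hE : Tsirelson.Admissible E)
    (φ : StrongDual ℝ TsirelsonSpace) : ∑ j, Tsirelson.norm (block (E j) φ) ≤ 2 * ‖φ‖ := by
  have h1 := Tsirelson.half_sum_norm_restrict_le hE (block (Finset.univ.biUnion E) φ)
  have h2 : ∀ j, Tsirelson.restrict (E j) (block (Finset.univ.biUnion E) φ) = block (E j) φ := by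
    intro j
    ext n
    rw [Tsirelson.restrict_apply, block_apply, block_apply]
    by_cases hn : n ∈ E j
    · rw [if_pos hn, if_pos hn, if_pos (Finset.mem_biUnion.2 ⟨j, Finset.mem_univ j, hn⟩)]
    · rw [if_neg hn, if_neg hn]
  simp only [h2] at h1
  linarith [norm_block_le (Finset.univ.biUnion E) φ]

/-- The basis of `T` is boundedly complete: if the tails of `φ` did not tend to zero, an admissible
family of many successive blocks of norm at least `δ` would make the norm of `φ` too large. -/
theorem exists_forall_norm_block_le (φ : StrongDual ℝ TsirelsonSpace) {δ : ℝ} (hδ : 0 < δ) :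
    ∃ N, ∀ E : Finset ℕ, (∀ n ∈ E, N ≤ n) → Tsirelson.norm (block E φ) ≤ δ := by
  by_contra! h
  choose E hE hlt using h
  obtain ⟨k, hk⟩ := exists_nat_gt (2 * ‖φ‖ / δ)
  let next : ℕ → ℕ := fun N => max N ((E N).sup id + 1)
  let N : ℕ → ℕ := fun i => next^[i] k
  have hNs : ∀ i, N (i + 1) = next (N i) := fun i => Function.iterate_succ_apply' _ _ _
  have hN : Monotone N := monotone_nat_of_le_succ fun i => by
    rw [hNs]
    exact le_max_left _ _
  have hadm : Tsirelson.Admissible fun j : Fin k => E (N j) := by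
    refine ⟨fun j n hn => ?_, fun i j hij p hp q hq => ?_⟩
    · have h1 := hE _ n hn
      have h2 : k ≤ N j := hN (Nat.zero_le _)
      omega
    · have h1 := hE _ q hq
      have h2 : N (i + 1) ≤ N j := hN (Nat.succ_le_of_lt hij)
      have h3 : p ≤ (E (N i)).sup id := Finset.le_sup (f := id) hp
      have h4 : (E (N i)).sup id + 1 ≤ N (i + 1) := by
        rw [hNs]
        exact le_max_right _ _
      omega
  have h1 := sum_norm_block_le hadm φ
  have h2 : (k : ℝ) * δ ≤ ∑ j : Fin k, Tsirelson.norm (block (E (N j)) φ) := by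
    refine le_trans (le_of_eq ?_) (Finset.sum_le_sum fun j _ => (hlt (N j)).le)
    simp
  rw [div_lt_iff₀ hδ] at hk
  linarith

/-! ### Summability of the Szlenk index of `𝕋` -/

/-- A functional in the iterated derivation of the dual ball can be perturbed, far out and by one
new block of norm about `ε_i / 2` for each derivation, to an element `ψ` of the ball. -/
theorem exists_blocks_of_mem_iteratedSzlenkDerivation :
    ∀ ε : List ℝ, ∀ φ ∈ iteratedSzlenkDerivation ε
      (Metric.closedBall (0 : StrongDual ℝ TsirelsonSpace) 1), ∀ (N : ℕ) (η : ℝ), 0 < η →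
    ∃ ψ : StrongDual ℝ TsirelsonSpace, ‖ψ‖ ≤ 1 ∧ ∃ E : Fin ε.length → Finset ℕ,
      (∀ j, ∀ n ∈ E j, N ≤ n) ∧ (∀ i j, i < j → ∀ m ∈ E i, ∀ n ∈ E j, m < n) ∧
      Tsirelson.norm (block (Finset.range N) (ψ - φ)) ≤ η ∧
      ε.sum / 2 - η ≤ ∑ j, Tsirelson.norm (block (E j) ψ) := by
  intro ε
  induction ε with
  | nil =>
    intro φ hφ N η hη
    refine ⟨φ, by simpa [iteratedSzlenkDerivation] using hφ, Fin.elim0, fun j => j.elim0,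
      fun j => j.elim0, ?_, ?_⟩
    · rw [sub_self, map_zero, Tsirelson.norm_zero]
      exact hη.le
    · simp [hη.le]
  | cons e ε ih =>
    intro φ hφ N η hη
    have hη4 : 0 < η / 4 := by positivity
    obtain ⟨N', hN'⟩ := exists_forall_norm_block_le φ hη4
    obtain ⟨N₀, hN₀⟩ : ∃ N₀, N₀ = max N N' := ⟨_, rfl⟩
    -- `φ₁` lies in the less derived set, is close to `φ` on `[0, N₀)` and far from `φ` in norm; as
    -- the tail of `φ` is small, the distance comes from a block of `φ₁` itself beyond `N₀`.
    let U : Set (WeakDual ℝ TsirelsonSpace) :=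
      {χ | ∑ n ∈ Finset.range N₀, |χ (unit n) - φ (unit n)| < η / 4}
    have hU : IsOpen U := by
      refine isOpen_lt (continuous_finsetSum _ fun n _ => ?_) continuous_const
      exact ((WeakDual.eval_continuous (unit n)).sub continuous_const).abs
    obtain ⟨φ₁, hφ₁, hφ₁U, hfar⟩ := exists_norm_sub_gt_of_mem_szlenkDerivation hφ hU
      (by
        change ∑ n ∈ Finset.range N₀, |φ (unit n) - φ (unit n)| < η / 4
        simpa using hη4)
    have hclose : Tsirelson.norm (block (Finset.range N₀) (φ₁ - φ)) ≤ η / 4 :=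
      (norm_block_le_sum _ _).trans (le_of_lt hφ₁U)
    obtain ⟨M, hM⟩ : ∃ M, e / 2 < Tsirelson.norm (block (Finset.range M) (φ₁ - φ)) := by
      by_contra! h
      exact hfar.not_ge (norm_le_of_norm_block_le h)
    obtain ⟨N₁, hN₁⟩ : ∃ N₁, N₁ = max M N₀ := ⟨_, rfl⟩
    obtain ⟨ψ, hψ, E, hEN, hEs, hψφ, hsum⟩ := ih φ₁ hφ₁ N₁ (η / 4) hη4
    have hsplit : block (Finset.range N₁) (φ₁ - φ) = block (Finset.range N₀) (φ₁ - φ) +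
        (block (Finset.Ico N₀ N₁) φ₁ + -block (Finset.Ico N₀ N₁) φ) := by
      ext n
      rw [Finsupp.add_apply, Finsupp.add_apply, Finsupp.neg_apply, block_apply, block_apply,
        block_apply, block_apply]
      simp only [Finset.mem_range, Finset.mem_Ico]
      have hle : N₀ ≤ N₁ := by omega
      by_cases h1 : n < N₀
      · simp [h1, h1.trans_le hle, h1.not_ge]
      · by_cases h2 : n < N₁
        · simp [h1, h2, not_lt.1 h1, sub_eq_add_neg]
        · simp [h1, h2]
    have hneg : Tsirelson.norm (-block (Finset.Ico N₀ N₁) φ) ≤ η / 4 := by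
      rw [← map_neg]
      refine le_trans (Tsirelson.norm_mono fun n => ?_) (hN' (Finset.Ico N₀ N₁) fun n hn => ?_)
      · simp
      · have := (Finset.mem_Ico.1 hn).1
        omega
    have hblock₁ : e / 2 - η / 2 ≤ Tsirelson.norm (block (Finset.Ico N₀ N₁) φ₁) := by
      have h1 := norm_block_mono (Finset.range_subset_range.2 (show M ≤ N₁ by omega)) (φ₁ - φ)
      rw [hsplit] at h1
      have h2 := Tsirelson.norm_add_le (block (Finset.range N₀) (φ₁ - φ))
        (block (Finset.Ico N₀ N₁) φ₁ + -block (Finset.Ico N₀ N₁) φ)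
      have h3 := Tsirelson.norm_add_le (block (Finset.Ico N₀ N₁) φ₁)
        (-block (Finset.Ico N₀ N₁) φ)
      linarith
    have hblock : e / 2 - 3 * (η / 4) ≤ Tsirelson.norm (block (Finset.Ico N₀ N₁) ψ) := by
      have h1 : Tsirelson.norm (block (Finset.Ico N₀ N₁) (φ₁ - ψ)) ≤ η / 4 := by
        refine le_trans (Tsirelson.norm_mono fun n => ?_) hψφ
        rw [block_apply, block_apply]
        by_cases hn : n ∈ Finset.Ico N₀ N₁
        · rw [if_pos hn, if_pos (Finset.mem_range.2 (Finset.mem_Ico.1 hn).2)]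
          exact (abs_sub_comm _ _).le
        · rw [if_neg hn, abs_zero]
          exact abs_nonneg _
      have h2 := Tsirelson.norm_add_le (block (Finset.Ico N₀ N₁) (φ₁ - ψ))
        (block (Finset.Ico N₀ N₁) ψ)
      rw [← map_add, sub_add_cancel] at h2
      linarith
    refine ⟨ψ, hψ, Fin.cons (Finset.Ico N₀ N₁) E, fun j => ?_, fun i j => ?_, ?_, ?_⟩
    · refine Fin.cases (fun n hn => ?_) (fun j n hn => ?_) j
      · rw [Fin.cons_zero] at hn
        have := (Finset.mem_Ico.1 hn).1
        omega
      · rw [Fin.cons_succ] at hn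
        have := hEN j n hn
        omega
    · refine Fin.cases (fun h => absurd h (Fin.not_lt_zero i)) (fun j => ?_) j
      refine Fin.cases (fun _ m hm n hn => ?_) (fun i hij m hm n hn => ?_) i
      · rw [Fin.cons_zero] at hm
        rw [Fin.cons_succ] at hn
        have h1 := (Finset.mem_Ico.1 hm).2
        have h2 := hEN j n hn
        omega
      · rw [Fin.cons_succ] at hm hn
        exact hEs i j (Fin.succ_lt_succ_iff.1 hij) m hm n hn
    · have h1 : block (Finset.range N) (ψ - φ)
          = block (Finset.range N) (ψ - φ₁) + block (Finset.range N) (φ₁ - φ) := by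
        rw [← map_add, sub_add_sub_cancel]
      rw [h1]
      refine (Tsirelson.norm_add_le _ _).trans ?_
      have h2 := norm_block_mono (Finset.range_subset_range.2 (show N ≤ N₁ by omega)) (ψ - φ₁)
      have h3 := norm_block_mono (Finset.range_subset_range.2 (show N ≤ N₀ by omega)) (φ₁ - φ)
      linarith
    · rw [List.sum_cons]
      change _ ≤ ∑ j : Fin (ε.length + 1), _
      rw [Fin.sum_univ_succ]
      simp only [Fin.cons_zero, Fin.cons_succ]
      linarith

theorem hasSummableSzlenkIndex : HasSummableSzlenkIndex TsirelsonSpace := by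
  refine ⟨5, fun ε _ ⟨φ, hφ⟩ => ?_⟩
  -- Blocks beyond the number of derivations form an admissible family.
  obtain ⟨ψ, hψ, E, hEN, hEs, -, hsum⟩ :=
    exists_blocks_of_mem_iteratedSzlenkDerivation ε φ hφ ε.length (1 / 2) (by norm_num)
  have h := sum_norm_block_le ⟨fun j n hn => Nat.lt_succ_of_le (hEN j n hn), hEs⟩ ψ
  linarith

end TsirelsonSpace

theorem mainTheorem4 :
    HasSummableSzlenkIndex TsirelsonSpace ∧ ¬ HasSummableSzlenkIndex TsirelsonSumC0 :=
  ⟨TsirelsonSpace.hasSummableSzlenkIndex, TsirelsonSumC0.not_hasSummableSzlenkIndex⟩
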